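/- **Setting.** Fix $d\ge 1$ and $D,B,P>0$, $\sigma^2\ge 0$; write $\mathtt{SNR}=P/\sigma^2$, where $\sigma^2=0$ (a noiseless channel) is the case $\mathtt{SNR}=\infty$; $\log$ is to the base $2$. For a nonempty convex set $\mathcal X\subset\mathbb R^d$ of diameter at most $D$, let $\mathcal O$ be the set of pairs $(f,O)$ of a convex function $f:\mathcal X\to\mathbb R$ and an oracle $O$ that answers each query $x\in\mathcal X$ with a fresh random vector $\hat g(x)\in\mathbb R^d$ with $\mathbb E[\hat g(x)]\in\partial f(x)$ and $\mathbb E\|\hat g(x)\|^2\le B^2$. A code of length $\ell\ge1$ is an encoder $\varphi:\mathbb R^d\times\mathcal U\to\mathbb R^\ell$ with public randomness $U\in\mathcal U$. In round $t=1,\dots,T$ an algorithm $\pi$ queries the oracle at a point $x_t\in\mathcal X$, which depends on its randomness (including the public randomness) and on the earlier channel outputs; the oracle output $\hat g_t$ is encoded as $\varphi(\hat g_t,U_t)$, with $\mathbb E\|\varphi(\hat g_t,U_t)\|^2\le\ell P$ and every $U_t$ distributed as $U$; and $\pi$ observes $Y_t=\varphi(\hat g_t,U_t)+Z_t$ with independent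 noise $Z_t\sim\mathcal N(0,\sigma^2 I_\ell)$. After $T$ queries $\pi$ outputs $x_{\rm out}\in\mathcal X$. The code is a *$k$-coordinate sampling code* if the codeword of $x$ consists only of the values of $k$ coordinates of $x$ and their indices, i.e. $\varphi(x)$ represents (given $U$) a pair $(S,\{x(i)\}_{i\in S})$ with $S\subset[d]$, $|S|=k$, where $S$ may depend on $x$ (top-$k$ is an example). Let $$\mathcal E^*_{{\tt k}cs}(N)=\sup_{\mathcal X}\ \inf_{(\pi,\varphi):\ \ell T\le N}\ \sup_{(f,O)\in\mathcal O}\ \Big(\mathbb E f(x_{\rm out})-\inf_{\mathcal X}f\Big),$$ where the infimum is over protocols whose code $\varphi$ is a $k$-coordinate sampling code. **Lemma.** There is a universal constant $c>0$ such that, for all $D,B,P>0$ and $\sigma^2\ge0$ (hence for all values of $\mathtt{SNR}$, including $\mathtt{SNR}=\infty$), the following hold. 1. If $1\le k\le d/2$ and $N\ge d/\min\{d,k\log\frac dk\}$, then $$\mathcal E^*_{{\tt k}cs}(N)\ \ge\ \frac{cDB}{\sqrt N}\sqrt{\frac{d}{\min\{d,\,k\log\frac dk\}}}.$$ 2. If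 $1\le k\le d$ and $N\ge d/\min\{d,k(1+\log\frac dk)\}$, then $$\mathcal E^*_{{\tt k}cs}(N)\ \ge\ \frac{cDB}{\sqrt N}\sqrt{\frac{d}{\min\{d,\,k(1+\log\frac dk)\}}}.$$ In particular such codes do not attain the classic rate $O(DB/\sqrt N)$ even at infinite $\mathtt{SNR}$: for every $C>0$ there is $\varepsilon\in(0,1/2]$ such that, for $\sigma^2=0$, all $D,B,P>0$, all $1\le k\le\varepsilon d$ and all $N\ge d/\min\{d,k\log\frac dk\}$, $\mathcal E^*_{{\tt k}cs}(N)\ge C\,DB/\sqrt N$. -/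

import Mathlib

open MeasureTheory ProbabilityTheory
open scoped ENNReal NNReal

namespace OverTheAir

/-- The Euclidean space `ℝ^d`. -/
abbrev Vec (d : ℕ) : Type := EuclideanSpace ℝ (Fin d)

/-- `g` is a subgradient at `x` of the function `f` on the domain `X`. -/
def IsSubgradientOn {d : ℕ} (X : Set (Vec d)) (f : Vec d → ℝ) (x g : Vec d) : Prop :=
  ∀ y ∈ X, f x + inner ℝ g (y - x) ≤ f y

/-- A pair `(f, O)`: a convex function on `X` (only its values on `X` matter) and a first order
oracle for it. When `x` is queried, the oracle answers with a fresh sample of `oracle x`; for every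
`x ∈ X` its mean is a subgradient of `f` at `x`, and its second moment is at most `B ^ 2`. -/
structure OraclePair {d : ℕ} (X : Set (Vec d)) (B : ℝ) where
  f : Vec d → ℝ
  oracle : Kernel (Vec d) (Vec d)
  markov : IsMarkovKernel oracle
  convex : ConvexOn ℝ X f
  unbiased : ∀ x ∈ X, IsSubgradientOn X f x (∫ g, g ∂(oracle x))
  meanSquare : ∀ x ∈ X, ∫⁻ g, ‖g‖ₑ ^ 2 ∂(oracle x) ≤ ENNReal.ofReal (B ^ 2)

/-- An encoder `φ : ℝ^d × 𝒰 → ℝ^ℓ`, randomized by public randomness with law `law` on `𝒰`. -/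
structure Code (d ℓ : ℕ) where
  𝒰 : Type
  mU : MeasurableSpace 𝒰
  law : Measure 𝒰
  prob : IsProbabilityMeasure law
  enc : Vec d → 𝒰 → (Fin ℓ → ℝ)
  measurable_enc : Measurable (fun q : Vec d × 𝒰 => enc q.1 q.2)

attribute [instance] Code.mU Code.prob OraclePair.markov

/-- The codeword for `x` consists only of the values of `k` coordinates of `x` and their indices:
it is determined (given the public randomness) by a set `S` of `k` coordinates, which may depend
on `x`, together with `{x(i)}_{i ∈ S}`. The map `e` is the representation of such a pair
by a vector of channel inputs. -/
def Code.IsCoordinateSampling {d ℓ : ℕ} (k : ℕ) (φ : Code d ℓ) : Prop :=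
  ∃ (S : Vec d → φ.𝒰 → Finset (Fin d))
    (e : φ.𝒰 → (s : Finset (Fin d)) → (s → ℝ) → (Fin ℓ → ℝ)),
    (∀ x u, (S x u).card = k) ∧
    ∀ x u, φ.enc x u = e u (S x u) (fun i => x i)

/-- An optimization algorithm on `X` making `T` oracle queries (numbered `0, …, T - 1`) through
the code `φ`. The point `ω` carries all randomness of the algorithm, public and private; `U t ω` is
the public randomness that the encoder uses for the `t`-th query. The `t`-th query depends on
`ω` and on the first `t` channel outputs, the final output on `ω` and all `T` channel outputs.
(Entries `U t`, `query t` with `t ≥ T` play no role.) -/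
structure Algorithm {d ℓ : ℕ} (X : Set (Vec d)) (T : ℕ) (φ : Code d ℓ) where
  Ω : Type
  mΩ : MeasurableSpace Ω
  μ : Measure Ω
  prob : IsProbabilityMeasure μ
  U : ℕ → Ω → φ.𝒰
  measurable_U : ∀ t, Measurable (U t)
  law_U : ∀ t, μ.map (U t) = φ.law
  query : (t : ℕ) → Ω × (Fin t → Fin ℓ → ℝ) → Vec d
  measurable_query : ∀ t, Measurable (query t)
  query_mem : ∀ t s, query t s ∈ X
  output : Ω × (Fin T → Fin ℓ → ℝ) → Vec d
  measurable_output : Measurable output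
  output_mem : ∀ s, output s ∈ X

attribute [instance] Algorithm.mΩ Algorithm.prob

/-- The noise of `ℓ` uses of the Gaussian channel: i.i.d. `𝒩(0, σ²)` coordinates.
For `σ² = 0` the channel is noiseless. -/
noncomputable def channelNoise (ℓ : ℕ) (σ2 : ℝ≥0) : Measure (Fin ℓ → ℝ) :=
  Measure.pi (fun _ => gaussianReal 0 σ2)

section

variable {d ℓ T : ℕ} {X : Set (Vec d)} {φ : Code d ℓ}

/-- The joint law of the randomness `ω` and the first `t` channel outputs `Y_0, …, Y_{t-1}`:
in round `t` the oracle draws `ĝ ∼ oracle (query t)`, and the output `φ(ĝ, U_t) + Z`, with fresh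
channel noise `Z`, is appended. -/
noncomputable def Algorithm.transcriptLaw (π : Algorithm X T φ) (σ2 : ℝ≥0)
    (O : Kernel (Vec d) (Vec d)) : (t : ℕ) → Measure (π.Ω × (Fin t → Fin ℓ → ℝ))
  | 0 => π.μ.map (fun ω => (ω, fun i => i.elim0))
  | t + 1 =>
    (((π.transcriptLaw σ2 O t).compProd (O.comap (π.query t) (π.measurable_query t))).prod
        (channelNoise ℓ σ2)).map
      (fun s => (s.1.1.1,
        Fin.snoc (α := fun _ => Fin ℓ → ℝ) s.1.1.2 (φ.enc s.1.2 (π.U t s.1.1.1) + s.2)))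

/-- The average power constraint `E ‖φ(ĝ_t, U_t)‖² ≤ ℓ P`, for each of the `T` transmitted
codewords and whatever the function and the oracle are. -/
def Algorithm.SatisfiesPower (π : Algorithm X T φ) (B P : ℝ) (σ2 : ℝ≥0) : Prop :=
  ∀ (p : OraclePair X B) (t : ℕ), t < T →
    ∫⁻ s, ENNReal.ofReal (∑ i, (φ.enc s.2 (π.U t s.1.1) i) ^ 2)
      ∂((π.transcriptLaw σ2 p.oracle t).compProd
        (p.oracle.comap (π.query t) (π.measurable_query t)))
      ≤ ENNReal.ofReal (ℓ * P)

/-- The convergence error: the expectation of `f (x_T) - min_X f`, which is nonnegative. -/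
noncomputable def Algorithm.error {B : ℝ} (π : Algorithm X T φ) (σ2 : ℝ≥0)
    (p : OraclePair X B) : ℝ≥0∞ :=
  ∫⁻ s, ENNReal.ofReal (p.f (π.output s) - sInf (p.f '' X)) ∂(π.transcriptLaw σ2 p.oracle T)

end

/-- The min-max error with `N` channel uses on domains of diameter at most `D`, when the codes are
restricted to the class `𝒞`. -/
noncomputable def minMaxError (𝒞 : ∀ d ℓ : ℕ, Code d ℓ → Prop) (d N : ℕ) (D B P : ℝ)
    (σ2 : ℝ≥0) : ℝ≥0∞ :=
  ⨆ (X : Set (Vec d)) (_ : X.Nonempty) (_ : Convex ℝ X) (_ : ∀ x ∈ X, ∀ y ∈ X, ‖x - y‖ ≤ D),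
    ⨅ (ℓ : ℕ) (T : ℕ) (_ : 1 ≤ ℓ) (_ : ℓ * T ≤ N) (φ : Code d ℓ) (_ : 𝒞 d ℓ φ)
      (π : Algorithm X T φ) (_ : π.SatisfiesPower B P σ2),
      ⨆ p : OraclePair X B, π.error σ2 p

/-- The min-max error of `k`-coordinate sampling codes. -/
noncomputable def kcsError (k d N : ℕ) (D B P : ℝ) (σ2 : ℝ≥0) : ℝ≥0∞ :=
  minMaxError (fun _ _ φ => φ.IsCoordinateSampling k) d N D B P σ2

end OverTheAir

/-!
The domain is the cube `[-r, r]^d` with `r = D / (2 √d)`. For each sign vector `v` there is an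
affine function on it, proportional to `‖x - r v‖₁`, whose oracle answers every query with a random
vertex of a cube in `ℝ^d`, with independent coordinates of bias `δ` against those of `v`. The error
of an output is at least the Hamming distance between its signs and `v`, up to scale, and by
Assouad's lemma that distance is of order `d` for some `v` unless the channel outputs carry enough
information on `v`.

As an answer has only two values per coordinate, a `k`-coordinate sampling code sends at most
`log (2 ^ k * d.choose k)` nats, which is of order `k (1 + log (d / k))`. The score of the answer is
a sub-Gaussian vector with `d` bounded coordinates. Hence the trace of the Fisher information of a
message is at most a constant times `d`, by the Cauchy–Schwarz inequality, and at most a constant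
times the logarithm of the number of messages: conditioned on an event of probability `p`, the mean
of the score has norm at most `√(2 log (1 / p))`. The channel noise is independent of `v` and only
makes things worse. A bias with `δ² ~ d / (N min {d, k (1 + log (d / k))})` therefore leaves `v`
undetermined after `N` queries.
-/

namespace OverTheAir

section FiniteLaws

open Finset

variable {ι α : Type*} [Fintype ι] [Fintype α]

/-- The weights `p` as a probability mass function, which gives access to measure theory. -/
noncomputable def toPMF {p : α → ℝ} (hp : p ∈ stdSimplex ℝ α) : PMF α :=
  PMF.ofFintype (fun a => ENNReal.ofReal (p a)) <| by
    rw [← ENNReal.ofReal_sum_of_nonneg fun a _ => hp.1 a, hp.2, ENNReal.ofReal_one]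

@[simp]
theorem toPMF_apply {p : α → ℝ} (hp : p ∈ stdSimplex ℝ α) (a : α) :
    toPMF hp a = ENNReal.ofReal (p a) := rfl

theorem integral_toPMF {E : Type*} [NormedAddCommGroup E] [NormedSpace ℝ E] [CompleteSpace E]
    [MeasurableSpace α] [MeasurableSingletonClass α] {p : α → ℝ} (hp : p ∈ stdSimplex ℝ α)
    (f : α → E) :
    ∫ a, f a ∂(toPMF hp).toMeasure = ∑ a, p a • f a := by
  simp only [PMF.integral_eq_sum, toPMF_apply, fun a => ENNReal.toReal_ofReal (hp.1 a)]

theorem toMeasure_toPMF_singleton [MeasurableSpace α] [MeasurableSingletonClass α] {p : α → ℝ}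
    (hp : p ∈ stdSimplex ℝ α) (a : α) : (toPMF hp).toMeasure {a} = ENNReal.ofReal (p a) := by
  rw [PMF.toMeasure_apply_singleton _ _ (measurableSet_singleton a), toPMF_apply]

theorem prod_mem_stdSimplex [DecidableEq ι] {p : ι → α → ℝ} (hp : ∀ i, p i ∈ stdSimplex ℝ α) :
    (fun x : ι → α => ∏ i, p i (x i)) ∈ stdSimplex ℝ (ι → α) :=
  ⟨fun x => prod_nonneg fun i _ => (hp i).1 (x i), by
    simp only [← Fintype.prod_sum p, (hp _).2, prod_const_one]⟩

theorem sum_prod_mul_apply [DecidableEq ι] {p : ι → α → ℝ} (hp : ∀ i, ∑ a, p i a = 1) (i : ι)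
    (f : α → ℝ) : ∑ x : ι → α, (∏ j, p j (x j)) * f (x i) = ∑ a, p i a * f a := by
  have hterm (x : ι → α) : (∏ j, p j (x j)) * f (x i) =
      ∏ j, p j (x j) * if j = i then f (x j) else 1 := by
    simp only [prod_mul_distrib, prod_ite_eq', mem_univ, if_true]
  simp only [hterm]
  rw [← Fintype.prod_sum fun j a => p j a * if j = i then f a else 1, prod_eq_single i]
  · simp only [if_true]
  · intro j _ hj
    simp only [if_neg hj, mul_one, hp]
  · simp

/-! ### Sub-Gaussian scores -/

theorem sum_mul_exp_le_of_mem_Icc {p : α → ℝ} (hp : p ∈ stdSimplex ℝ α) {f : α → ℝ} {a b : ℝ}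
    (hf : ∀ x, f x ∈ Set.Icc a b) (hmean : ∑ x, p x * f x = 0) (l : ℝ) :
    ∑ x, p x * Real.exp (l * f x) ≤ Real.exp (((b - a) / 2) ^ 2 * l ^ 2 / 2) := by
  let _ : MeasurableSpace α := ⊤
  have hoeffding := (hasSubgaussianMGF_of_mem_Icc_of_integral_eq_zero
    (μ := (toPMF hp).toMeasure) (X := f) measurable_from_top.aemeasurable
    (ae_of_all _ hf) (by simpa only [integral_toPMF, smul_eq_mul] using hmean)).mgf_le l
  simpa only [mgf, integral_toPMF, smul_eq_mul, NNReal.coe_pow, NNReal.coe_div, coe_nnnorm,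
    Real.norm_eq_abs, NNReal.coe_ofNat, div_pow, sq_abs] using hoeffding

theorem sum_prod_mul_exp_le [DecidableEq ι] {p : ι → α → ℝ} (hp : ∀ i a, 0 ≤ p i a)
    {f : ι → α → ℝ} (hf : ∀ i l, ∑ a, p i a * Real.exp (l * f i a) ≤ Real.exp (l ^ 2 / 2))
    (l : ι → ℝ) :
    ∑ x : ι → α, (∏ i, p i (x i)) * Real.exp (∑ i, l i * f i (x i)) ≤
      Real.exp ((∑ i, l i ^ 2) / 2) := by
  simp only [sum_div, Real.exp_sum, ← prod_mul_distrib]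
  rw [← Fintype.prod_sum fun i a => p i a * Real.exp (l i * f i a)]
  exact prod_le_prod
    (fun i _ => sum_nonneg fun a _ => mul_nonneg (hp i a) (Real.exp_pos _).le) fun i _ => hf i _

theorem sum_mul_exp_div_sum_le {β : Type*} {A : Finset β} {w : β → ℝ} (hw : ∀ x ∈ A, 0 ≤ w x)
    (hA : 0 < ∑ x ∈ A, w x) (f : β → ℝ) :
    (∑ x ∈ A, w x) * Real.exp ((∑ x ∈ A, w x * f x) / ∑ x ∈ A, w x) ≤
      ∑ x ∈ A, w x * Real.exp (f x) := by
  have jensen := convexOn_exp.map_centerMass_le (p := f) hw hA fun _ _ => Set.mem_univ _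
  simp only [centerMass, smul_eq_mul, Function.comp_apply, inv_mul_eq_div] at jensen
  rw [mul_comm]
  exact (le_div_iff₀ hA).1 jensen

theorem sum_sq_sum_mul_le_of_subgaussian {β : Type*} [Fintype β] {w : β → ℝ} (hw : ∀ x, 0 ≤ w x)
    {s : β → ι → ℝ}
    (hs : ∀ l : ι → ℝ, ∑ x, w x * Real.exp (∑ i, l i * s x i) ≤ Real.exp ((∑ i, l i ^ 2) / 2))
    (A : Finset β) :
    ∑ i, (∑ x ∈ A, w x * s x i) ^ 2 ≤ 2 * (∑ x ∈ A, w x) * Real.negMulLog (∑ x ∈ A, w x) := by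
  set p := ∑ x ∈ A, w x
  set b : ι → ℝ := fun i => ∑ x ∈ A, w x * s x i with hb
  obtain hp0 | hp0 : p = 0 ∨ 0 < p := (sum_nonneg fun x _ => hw x).eq_or_lt.imp_left Eq.symm
  · have hw0 := (sum_eq_zero_iff_of_nonneg fun x _ => hw x).1 hp0
    have hb0 (i : ι) : ∑ x ∈ A, w x * s x i = 0 :=
      sum_eq_zero fun x hx => by rw [hw0 x hx, zero_mul]
    simp [hb0, hp0]
  have hmean : (∑ x ∈ A, w x * ∑ i, b i / p * s x i) / p = (∑ i, b i ^ 2) / p ^ 2 := by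
    simp only [mul_sum]
    rw [sum_comm, sum_div, sum_div]
    refine sum_congr rfl fun i _ => ?_
    simp only [mul_left_comm _ (b i / p), ← mul_sum]
    simp only [hb]
    ring
  -- The exponential moment is tested at `l = b / p`.
  have hexp : p * Real.exp ((∑ i, b i ^ 2) / p ^ 2) ≤ Real.exp ((∑ i, b i ^ 2) / p ^ 2 / 2) :=
    calc _ ≤ ∑ x ∈ A, w x * Real.exp (∑ i, b i / p * s x i) :=
          hmean ▸ sum_mul_exp_div_sum_le (fun x _ => hw x) hp0 _
      _ ≤ ∑ x, w x * Real.exp (∑ i, b i / p * s x i) :=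
          sum_le_univ_sum_of_nonneg fun x => mul_nonneg (hw x) (Real.exp_pos _).le
      _ ≤ Real.exp ((∑ i, (b i / p) ^ 2) / 2) := hs _
      _ = _ := by simp only [div_pow, sum_div]
  have hlog := Real.log_le_log (by positivity) hexp
  rw [Real.log_mul hp0.ne' (Real.exp_pos _).ne', Real.log_exp, Real.log_exp] at hlog
  have hdiv : (∑ i, b i ^ 2) / p ^ 2 ≤ -2 * Real.log p := by linarith
  rw [div_le_iff₀ (by positivity)] at hdiv
  rw [Real.negMulLog]
  linarith

theorem sum_negMulLog_le {p : α → ℝ} (hp : p ∈ stdSimplex ℝ α) :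
    ∑ a, Real.negMulLog (p a) ≤ Real.log (Fintype.card α) := by
  have : Nonempty α := not_isEmpty_iff.1 fun _ => by simpa using hp.2
  have hcard : (0 : ℝ) < Fintype.card α := by exact_mod_cast Fintype.card_pos
  have jensen := Real.concaveOn_negMulLog.le_map_sum (t := univ) (p := p)
    (w := fun _ => (Fintype.card α : ℝ)⁻¹) (fun _ _ => inv_nonneg.2 hcard.le)
    (by simp [hcard.ne']) fun a _ => hp.1 a
  simp only [smul_eq_mul, ← mul_sum, hp.2, mul_one, Real.negMulLog, Real.log_inv,
    neg_mul_neg] at jensen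
  exact le_of_mul_le_mul_left jensen (inv_pos.2 hcard)

/-! ### The information in a message -/

section Pushforward

variable {β : Type*} [Fintype β] [DecidableEq α]

/-- The law of `m x` when `x` has law `w`. The weights are arbitrary reals, so that `pushforward`
also applies to the differences of two laws. -/
def pushforward (m : β → α) (w : β → ℝ) (a : α) : ℝ := ∑ x with m x = a, w x

theorem pushforward_mem_stdSimplex (m : β → α) {w : β → ℝ} (hw : w ∈ stdSimplex ℝ β) :
    pushforward m w ∈ stdSimplex ℝ α :=
  ⟨fun _ => sum_nonneg fun x _ => hw.1 x, (sum_fiberwise univ m w).trans hw.2⟩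

theorem pushforward_mul_eq_zero {γ : Type*} [DecidableEq γ] {m : β → γ} {w : β → ℝ}
    (hw : ∀ x, 0 ≤ w x) {c : γ} (hc : pushforward m w c = 0) (f : β → ℝ) :
    pushforward m (fun x => w x * f x) c = 0 :=
  sum_eq_zero fun x hx => by
    rw [(sum_eq_zero_iff_of_nonneg fun x _ => hw x).1 hc x hx, zero_mul]

theorem sum_prod_mul_comp {w : ι → β → ℝ} [DecidableEq ι] (m : ι → β → α) (F : (ι → α) → ℝ) :
    ∑ g : ι → β, (∏ t, w t (g t)) * F (fun t => m t (g t)) =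
      ∑ y, (∏ t, pushforward (m t) (w t) (y t)) * F y := by
  rw [← sum_fiberwise univ fun (g : ι → β) t => m t (g t)]
  refine sum_congr rfl fun y _ => ?_
  have hfiber : ({g | (fun t => m t (g t)) = y} : Finset (ι → β)) =
      Fintype.piFinset fun t => {x | m t x = y t} := by
    ext g
    simp [funext_iff]
  simp only [pushforward]
  rw [prod_univ_sum, ← hfiber, sum_mul]
  exact sum_congr rfl fun g hg => by rw [(mem_filter.1 hg).2]

/-- The trace of the Fisher information of the message `m x`, where `x` has law `w` and score
function `s` (the derivative of the log-likelihood in the directions `ι`): the expected square norm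
of the conditional expectation of the score given the message. -/
noncomputable def fisherInfo (w : β → ℝ) (s : β → ι → ℝ) (m : β → α) : ℝ :=
  ∑ a, (∑ i, pushforward m (fun x => w x * s x i) a ^ 2) / pushforward m w a

theorem fisherInfo_le_sum_sq {w : β → ℝ} (hw : ∀ x, 0 ≤ w x) (s : β → ι → ℝ) (m : β → α) :
    fisherInfo w s m ≤ ∑ i, ∑ x, w x * s x i ^ 2 := by
  have cauchySchwarz (i : ι) (a : α) : pushforward m (fun x => w x * s x i) a ^ 2 ≤
      pushforward m (fun x => w x * s x i ^ 2) a * pushforward m w a :=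
    sum_sq_le_sum_mul_sum_of_sq_le_mul _ (fun x _ => mul_nonneg (hw x) (sq_nonneg _))
      (fun x _ => hw x) fun x _ => by linarith
  calc fisherInfo w s m ≤ ∑ a, ∑ i, pushforward m (fun x => w x * s x i ^ 2) a := by
        refine sum_le_sum fun a _ => div_le_of_le_mul₀ (sum_nonneg fun x _ => hw x)
          (sum_nonneg fun i _ => sum_nonneg fun x _ => mul_nonneg (hw x) (sq_nonneg _)) ?_
        rw [sum_mul]
        exact sum_le_sum fun i _ => cauchySchwarz i a
    _ = ∑ i, ∑ x, w x * s x i ^ 2 := by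
        rw [sum_comm]
        exact sum_congr rfl fun i _ => sum_fiberwise univ m _

theorem fisherInfo_le_two_mul_log_card {w : β → ℝ} (hw : w ∈ stdSimplex ℝ β) {s : β → ι → ℝ}
    (hs : ∀ l : ι → ℝ, ∑ x, w x * Real.exp (∑ i, l i * s x i) ≤ Real.exp ((∑ i, l i ^ 2) / 2))
    (m : β → α) : fisherInfo w s m ≤ 2 * Real.log (Fintype.card α) := by
  have hp := pushforward_mem_stdSimplex m hw
  calc fisherInfo w s m ≤ ∑ a, 2 * Real.negMulLog (pushforward m w a) := by
        refine sum_le_sum fun a _ => div_le_of_le_mul₀ (hp.1 a) ?_ ?_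
        · exact mul_nonneg zero_le_two
            (Real.negMulLog_nonneg (hp.1 a) (hp.2 ▸ single_le_sum (fun b _ => hp.1 b) (mem_univ a)))
        · rw [mul_right_comm]
          exact sum_sq_sum_mul_le_of_subgaussian hw.1 hs _
    _ ≤ 2 * Real.log (Fintype.card α) := by
        rw [← mul_sum]
        exact mul_le_mul_of_nonneg_left (sum_negMulLog_le hp) zero_le_two

end Pushforward

/-! ### Affinity and testing -/

/-- The Bhattacharyya affinity of two laws on a finite type. -/
noncomputable def affinity (p q : α → ℝ) : ℝ := ∑ a, √(p a) * √(q a)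

theorem affinity_nonneg (p q : α → ℝ) : 0 ≤ affinity p q :=
  sum_nonneg fun _ _ => by positivity

theorem one_sub_affinity {p q : α → ℝ} (hp : p ∈ stdSimplex ℝ α) (hq : q ∈ stdSimplex ℝ α) :
    1 - affinity p q = (∑ a, (√(p a) - √(q a)) ^ 2) / 2 := by
  have hterm (a : α) : (√(p a) - √(q a)) ^ 2 = p a + q a - 2 * (√(p a) * √(q a)) := by
    rw [sub_sq, Real.sq_sqrt (hp.1 a), Real.sq_sqrt (hq.1 a)]
    ring
  simp only [hterm, sum_sub_distrib, sum_add_distrib, hp.2, hq.2, ← mul_sum, affinity]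
  ring

theorem affinity_le_one {p q : α → ℝ} (hp : p ∈ stdSimplex ℝ α) (hq : q ∈ stdSimplex ℝ α) :
    affinity p q ≤ 1 := by
  have hsum : 0 ≤ (∑ a, (√(p a) - √(q a)) ^ 2) / 2 := by positivity
  linarith [one_sub_affinity hp hq]

theorem one_sub_affinity_le {p q : α → ℝ} (hp : p ∈ stdSimplex ℝ α) (hq : q ∈ stdSimplex ℝ α)
    (hpq : ∀ a, p a = 0 → q a = 0) :
    1 - affinity p q ≤ (∑ a, (p a - q a) ^ 2 / p a) / 2 := by
  rw [one_sub_affinity hp hq]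
  gcongr with a
  obtain h | h := (hp.1 a).eq_or_lt
  · simp [← h, hpq a h.symm]
  rw [le_div_iff₀ h]
  calc (√(p a) - √(q a)) ^ 2 * p a ≤ (√(p a) - √(q a)) ^ 2 * (√(p a) + √(q a)) ^ 2 := by
        gcongr
        nth_rw 1 [← Real.sq_sqrt h.le]
        gcongr
        exact le_add_of_nonneg_right (Real.sqrt_nonneg _)
    _ = (√(p a) ^ 2 - √(q a) ^ 2) ^ 2 := by ring
    _ = (p a - q a) ^ 2 := by rw [Real.sq_sqrt h.le, Real.sq_sqrt (hq.1 a)]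

theorem affinity_prod [DecidableEq ι] {p q : ι → α → ℝ} (hp : ∀ i a, 0 ≤ p i a)
    (hq : ∀ i a, 0 ≤ q i a) :
    affinity (fun y : ι → α => ∏ i, p i (y i)) (fun y => ∏ i, q i (y i)) =
      ∏ i, affinity (p i) (q i) := by
  simp only [affinity]
  rw [Fintype.prod_sum]
  refine sum_congr rfl fun y _ => ?_
  rw [Real.sqrt_prod _ fun i _ => hp i _, Real.sqrt_prod _ fun i _ => hq i _, prod_mul_distrib]

/-- Le Cam's inequality. -/
theorem sq_affinity_le_two_mul_sum_min {p q : α → ℝ} (hp : p ∈ stdSimplex ℝ α)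
    (hq : q ∈ stdSimplex ℝ α) : affinity p q ^ 2 ≤ 2 * ∑ a, min (p a) (q a) := by
  have hmin (a : α) : 0 ≤ min (p a) (q a) := le_min (hp.1 a) (hq.1 a)
  calc affinity p q ^ 2 ≤ (∑ a, max (p a) (q a)) * ∑ a, min (p a) (q a) :=
        sum_sq_le_sum_mul_sum_of_sq_le_mul _ (fun a _ => le_max_of_le_left (hp.1 a))
          (fun a _ => hmin a) fun a _ => by
            rw [mul_pow, Real.sq_sqrt (hp.1 a), Real.sq_sqrt (hq.1 a), max_mul_min]
    _ ≤ 2 * ∑ a, min (p a) (q a) := by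
        refine mul_le_mul_of_nonneg_right ?_ (sum_nonneg fun a _ => hmin a)
        calc ∑ a, max (p a) (q a) ≤ ∑ a, (p a + q a) :=
              sum_le_sum fun a _ => max_le_add_of_nonneg (hp.1 a) (hq.1 a)
          _ = 2 := by rw [sum_add_distrib, hp.2, hq.2, one_add_one_eq_two]

theorem one_sub_sum_one_sub_le_prod {J : Type*} (s : Finset J) {b : J → ℝ} (h0 : ∀ i, 0 ≤ b i)
    (h1 : ∀ i, b i ≤ 1) : 1 - ∑ i ∈ s, (1 - b i) ≤ ∏ i ∈ s, b i := by
  classical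
  induction s using Finset.induction_on with
  | empty => simp
  | insert i s hi ih =>
    rw [sum_insert hi, prod_insert hi]
    have hsum : 0 ≤ ∑ i ∈ s, (1 - b i) := sum_nonneg fun i _ => sub_nonneg.2 (h1 i)
    nlinarith [mul_le_mul_of_nonneg_left ih (h0 i), mul_nonneg (sub_nonneg.2 (h1 i)) hsum]

theorem half_sub_sum_one_sub_affinity_le_sum_min [DecidableEq ι] {p q : ι → α → ℝ}
    (hp : ∀ i, p i ∈ stdSimplex ℝ α) (hq : ∀ i, q i ∈ stdSimplex ℝ α) :
    1 / 2 - ∑ i, (1 - affinity (p i) (q i)) ≤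
      ∑ y : ι → α, min (∏ i, p i (y i)) (∏ i, q i (y i)) := by
  have leCam := sq_affinity_le_two_mul_sum_min (prod_mem_stdSimplex hp) (prod_mem_stdSimplex hq)
  rw [affinity_prod (fun i => (hp i).1) fun i => (hq i).1] at leCam
  have hprod := one_sub_sum_one_sub_le_prod univ (fun i => affinity_nonneg (p i) (q i))
    fun i => affinity_le_one (hp i) (hq i)
  nlinarith [sq_nonneg (∏ i, affinity (p i) (q i) - 1)]

theorem sum_one_sub_affinity_pushforward_le {β : Type*} [Fintype β] [DecidableEq α] {κ : ℝ}
    {w : β → ℝ} (hw : w ∈ stdSimplex ℝ β) {w' : ι → β → ℝ} (hw' : ∀ i, w' i ∈ stdSimplex ℝ β)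
    {s : β → ι → ℝ} (hs : ∀ i x, w' i x = w x * (1 - κ * s x i)) (m : β → α) :
    ∑ i, (1 - affinity (pushforward m w) (pushforward m (w' i))) ≤
      κ ^ 2 / 2 * fisherInfo w s m := by
  have hdiff (i : ι) (a : α) : pushforward m w a - pushforward m (w' i) a =
      κ * pushforward m (fun x => w x * s x i) a := by
    simp only [pushforward, hs, mul_sum, ← sum_sub_distrib]
    exact sum_congr rfl fun x _ => by ring
  calc ∑ i, (1 - affinity (pushforward m w) (pushforward m (w' i)))
      ≤ ∑ i, (∑ a, (κ * pushforward m (fun x => w x * s x i) a) ^ 2 / pushforward m w a) / 2 := by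
        refine sum_le_sum fun i _ => ?_
        simp only [← hdiff]
        refine one_sub_affinity_le (pushforward_mem_stdSimplex m hw)
          (pushforward_mem_stdSimplex m (hw' i)) fun a ha => ?_
        rw [show w' i = _ from funext (hs i)]
        exact pushforward_mul_eq_zero hw.1 ha _
    _ = κ ^ 2 / 2 * fisherInfo w s m := by
        simp only [fisherInfo, mul_sum, sum_div]
        rw [sum_comm]
        exact sum_congr rfl fun a _ => sum_congr rfl fun i _ => by ring

end FiniteLaws

/-! ### Biased laws on the cube -/

section Cube

open Finset

/-- The sign in `{-1, 1}` of a bit. -/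
def bitSign (b : Bool) : ℝ := if b then 1 else -1

theorem bitSign_mul_self (b : Bool) : bitSign b * bitSign b = 1 := by
  cases b <;> norm_num [bitSign]

/-- The law of a random bit `a` that equals `b` with probability `(1 + δ) / 2`. -/
noncomputable def bitProb (δ : ℝ) (b a : Bool) : ℝ := (1 + δ * (bitSign b * bitSign a)) / 2

/-- The score of the law `bitProb δ b`, up to a scalar: the agreement of the bit `a` with `b`,
centered. -/
def bitScore (δ : ℝ) (b a : Bool) : ℝ := bitSign b * bitSign a - δ

variable {δ : ℝ}

theorem sum_bitProb (b : Bool) : ∑ a, bitProb δ b a = 1 := by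
  cases b <;> simp only [bitProb, bitSign, Fintype.sum_bool] <;> norm_num <;> ring

theorem bitProb_mem_stdSimplex (hδ : |δ| ≤ 1) (b : Bool) : bitProb δ b ∈ stdSimplex ℝ Bool := by
  refine ⟨fun a => ?_, sum_bitProb b⟩
  have := abs_le.1 hδ
  cases a <;> cases b <;> norm_num [bitProb, bitSign] <;> linarith

theorem sum_bitProb_mul_bitSign (b : Bool) : ∑ a, bitProb δ b a * bitSign a = δ * bitSign b := by
  cases b <;> simp only [bitProb, bitSign, Fintype.sum_bool] <;> norm_num <;> ring

theorem sum_bitProb_mul_bitScore (b : Bool) : ∑ a, bitProb δ b a * bitScore δ b a = 0 := by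
  cases b <;> simp only [bitProb, bitScore, bitSign, Fintype.sum_bool] <;> norm_num <;> ring

theorem sum_bitProb_mul_bitScore_sq (b : Bool) :
    ∑ a, bitProb δ b a * bitScore δ b a ^ 2 = 1 - δ ^ 2 := by
  cases b <;> simp only [bitProb, bitScore, bitSign, Fintype.sum_bool] <;> norm_num <;> ring

theorem sum_bitProb_mul_exp_le (hδ : |δ| ≤ 1) (b : Bool) (l : ℝ) :
    ∑ a, bitProb δ b a * Real.exp (l * bitScore δ b a) ≤ Real.exp (l ^ 2 / 2) := by
  have hmem (a : Bool) : bitScore δ b a ∈ Set.Icc (-1 - δ) (1 - δ) := by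
    cases a <;> cases b <;> norm_num [bitScore, bitSign]
  refine (sum_mul_exp_le_of_mem_Icc (bitProb_mem_stdSimplex hδ b) hmem
    (sum_bitProb_mul_bitScore b) l).trans_eq ?_
  ring_nf

theorem bitProb_not (hδ : |δ| < 1) (b a : Bool) :
    bitProb δ (!b) a = bitProb δ b a * (1 - 2 * δ / (1 - δ ^ 2) * bitScore δ b a) := by
  have : 1 - δ ^ 2 ≠ 0 := (sub_pos.2 ((sq_lt_one_iff_abs_lt_one δ).2 hδ)).ne'
  cases a <;> cases b <;> norm_num [bitProb, bitScore, bitSign] <;> field_simp <;> ring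

variable {ι : Type*} [DecidableEq ι]

/-- The neighbour of the vertex `v` of the cube in direction `i`. -/
def flipBit (i : ι) (v : ι → Bool) : ι → Bool := Function.update v i (!v i)

theorem flipBit_apply_self (i : ι) (v : ι → Bool) : flipBit i v i = !v i :=
  Function.update_self ..

theorem flipBit_involutive (i : ι) : Function.Involutive (flipBit i) := fun v => by
  simp [flipBit]

variable [Fintype ι]

/-- The law of a point `x` of the cube with independent coordinates biased towards those of `v`. -/
noncomputable def cubeProb (δ : ℝ) (v x : ι → Bool) : ℝ := ∏ i, bitProb δ (v i) (x i)

/-- The score of `cubeProb δ v`, up to a scalar. -/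
def cubeScore (δ : ℝ) (v x : ι → Bool) (i : ι) : ℝ := bitScore δ (v i) (x i)

theorem cubeProb_mem_stdSimplex (hδ : |δ| ≤ 1) (v : ι → Bool) :
    cubeProb δ v ∈ stdSimplex ℝ (ι → Bool) :=
  prod_mem_stdSimplex fun i => bitProb_mem_stdSimplex hδ (v i)

theorem sum_cubeProb_mul_bitSign (v : ι → Bool) (i : ι) :
    ∑ x, cubeProb δ v x * bitSign (x i) = δ * bitSign (v i) :=
  (sum_prod_mul_apply (fun j => sum_bitProb (v j)) i _).trans (sum_bitProb_mul_bitSign (v i))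

theorem sum_cubeProb_mul_cubeScore_sq (v : ι → Bool) (i : ι) :
    ∑ x, cubeProb δ v x * cubeScore δ v x i ^ 2 = 1 - δ ^ 2 :=
  (sum_prod_mul_apply (fun j => sum_bitProb (v j)) i fun a => bitScore δ (v i) a ^ 2).trans
    (sum_bitProb_mul_bitScore_sq (v i))

theorem fisherInfo_cubeProb_le {α : Type*} [Fintype α] [DecidableEq α] (hδ : |δ| ≤ 1)
    (v : ι → Bool) (m : (ι → Bool) → α) :
    fisherInfo (cubeProb δ v) (cubeScore δ v) m ≤
      2 * min (Fintype.card ι : ℝ) (Real.log (Fintype.card α)) := by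
  have hw := cubeProb_mem_stdSimplex hδ v
  rw [mul_min_of_nonneg _ _ zero_le_two]
  refine le_min ?_ (fisherInfo_le_two_mul_log_card hw (fun l => ?_) m)
  · calc fisherInfo (cubeProb δ v) (cubeScore δ v) m ≤ ∑ _i : ι, (1 - δ ^ 2) := by
          simpa only [sum_cubeProb_mul_cubeScore_sq] using
            fisherInfo_le_sum_sq hw.1 (cubeScore δ v) m
      _ ≤ ∑ _i : ι, 2 := sum_le_sum fun i _ => by linarith [sq_nonneg δ]
      _ = 2 * Fintype.card ι := by rw [sum_const, card_univ, nsmul_eq_mul, mul_comm]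
  · exact sum_prod_mul_exp_le (fun i => (bitProb_mem_stdSimplex hδ (v i)).1)
      (fun i => sum_bitProb_mul_exp_le hδ (v i)) l

theorem cubeProb_flipBit (hδ : |δ| < 1) (i : ι) (v x : ι → Bool) :
    cubeProb δ (flipBit i v) x =
      cubeProb δ v x * (1 - 2 * δ / (1 - δ ^ 2) * cubeScore δ v x i) := by
  have hrest : ∏ j ∈ univ.erase i, bitProb δ (flipBit i v j) (x j) =
      ∏ j ∈ univ.erase i, bitProb δ (v j) (x j) := prod_congr rfl fun j hj => by
    rw [flipBit, Function.update_of_ne (ne_of_mem_erase hj)]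
  simp only [cubeProb, cubeScore]
  rw [← mul_prod_erase univ _ (mem_univ i), ← mul_prod_erase univ _ (mem_univ i), hrest,
    flipBit_apply_self, bitProb_not hδ]
  ring

theorem sum_one_sub_affinity_flipBit_le {α : Type*} [Fintype α] [DecidableEq α]
    (hδ : |δ| ≤ 1 / 2) (v : ι → Bool) (m : (ι → Bool) → α) :
    ∑ i, (1 - affinity (pushforward m (cubeProb δ v)) (pushforward m (cubeProb δ (flipBit i v)))) ≤
      8 * δ ^ 2 * min (Fintype.card ι : ℝ) (Real.log (Fintype.card α)) := by
  have hδ1 : |δ| < 1 := by linarith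
  have hscale : (2 * δ / (1 - δ ^ 2)) ^ 2 ≤ 8 * δ ^ 2 := by
    have h : 3 / 4 ≤ 1 - δ ^ 2 := by nlinarith [abs_nonneg δ, sq_abs δ]
    rw [div_pow, div_le_iff₀ (by positivity)]
    nlinarith [sq_nonneg δ, mul_le_mul h h (by norm_num) (by linarith)]
  calc _ ≤ (2 * δ / (1 - δ ^ 2)) ^ 2 / 2 * fisherInfo (cubeProb δ v) (cubeScore δ v) m :=
        sum_one_sub_affinity_pushforward_le (cubeProb_mem_stdSimplex hδ1.le v)
          (fun i => cubeProb_mem_stdSimplex hδ1.le (flipBit i v))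
          (fun i x => cubeProb_flipBit hδ1 i v x) m
    _ ≤ 8 * δ ^ 2 / 2 * (2 * min (Fintype.card ι : ℝ) (Real.log (Fintype.card α))) := by
        refine mul_le_mul (by gcongr) (fisherInfo_cubeProb_le hδ1.le v m) ?_ (by positivity)
        exact sum_nonneg fun a _ => div_nonneg (sum_nonneg fun i _ => sq_nonneg _)
          (sum_nonneg fun x _ => (cubeProb_mem_stdSimplex hδ1.le v).1 x)
    _ = 8 * δ ^ 2 * min (Fintype.card ι : ℝ) (Real.log (Fintype.card α)) := by ring

/-- Assouad's lemma: estimating all bits of `v` is at least as hard as testing `v` against each of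
its neighbours. -/
theorem sum_min_flipBit_le {Y : Type*} [Fintype Y] (Q : (ι → Bool) → Y → ℝ)
    (est : Y → ι → Bool) :
    ∑ v, ∑ i, ∑ y, min (Q v y) (Q (flipBit i v) y) ≤
      2 * ∑ v, ∑ y, Q v y * hammingDist (est y) v := by
  let err (v : ι → Bool) (i : ι) : ℝ := ∑ y, Q v y * if est y i ≠ v i then 1 else 0
  have htest (v : ι → Bool) (i : ι) :
      ∑ y, min (Q v y) (Q (flipBit i v) y) ≤ err v i + err (flipBit i v) i := by
    rw [← sum_add_distrib]
    refine sum_le_sum fun y _ => ?_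
    by_cases h : est y i = v i <;> simp [h, flipBit_apply_self]
  have hflip (i : ι) : ∑ v, err (flipBit i v) i = ∑ v, err v i :=
    Equiv.sum_comp (flipBit_involutive i).toPerm fun v => err v i
  have herr (v : ι → Bool) : ∑ i, err v i = ∑ y, Q v y * hammingDist (est y) v := by
    rw [sum_comm]
    simp only [← mul_sum, hammingDist, natCast_card_filter]
  calc ∑ v, ∑ i, ∑ y, min (Q v y) (Q (flipBit i v) y)
      ≤ ∑ v, ∑ i, (err v i + err (flipBit i v) i) :=
        sum_le_sum fun v _ => sum_le_sum fun i _ => htest v i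
    _ = 2 * ∑ v, ∑ i, err v i := by
        simp only [sum_add_distrib]
        rw [sum_comm (f := fun v i => err (flipBit i v) i), sum_congr rfl fun i _ => hflip i,
          sum_comm, two_mul]
    _ = 2 * ∑ v, ∑ y, Q v y * hammingDist (est y) v := by simp only [herr]

theorem le_sum_cubeProb_mul_hammingDist {α τ : Type*} [Fintype α] [Fintype τ]
    [DecidableEq τ] (hδ : |δ| ≤ 1 / 2)
    (hτ : Fintype.card τ * (8 * δ ^ 2 *
      min (Fintype.card ι : ℝ) (Real.log (Fintype.card α))) ≤ Fintype.card ι / 4)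
    (m : τ → (ι → Bool) → α) (est : (τ → α) → ι → Bool) :
    2 ^ Fintype.card ι * (Fintype.card ι / 8 : ℝ) ≤
      ∑ v : ι → Bool, ∑ g : τ → ι → Bool,
        (∏ t, cubeProb δ v (g t)) * hammingDist (est fun t => m t (g t)) v := by
  classical
  let P (v : ι → Bool) (t : τ) : α → ℝ := pushforward (m t) (cubeProb δ v)
  have hP1 (v : ι → Bool) (t : τ) : P v t ∈ stdSimplex ℝ α :=
    pushforward_mem_stdSimplex (m t) (cubeProb_mem_stdSimplex (by linarith) v)
  have hvertex (v : ι → Bool) : (Fintype.card ι / 4 : ℝ) ≤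
      ∑ i, ∑ y : τ → α, min (∏ t, P v t (y t)) (∏ t, P (flipBit i v) t (y t)) := by
    have hinfo : ∑ i, ∑ t, (1 - affinity (P v t) (P (flipBit i v) t)) ≤ Fintype.card ι / 4 := by
      rw [sum_comm]
      refine (sum_le_sum fun t _ => sum_one_sub_affinity_flipBit_le hδ v (m t)).trans ?_
      rwa [sum_const, card_univ, nsmul_eq_mul]
    calc (Fintype.card ι / 4 : ℝ)
        ≤ ∑ i : ι, (1 / 2 - ∑ t, (1 - affinity (P v t) (P (flipBit i v) t))) := by
          rw [sum_sub_distrib, sum_const, card_univ, nsmul_eq_mul]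
          linarith
      _ ≤ _ := sum_le_sum fun i _ =>
          half_sub_sum_one_sub_affinity_le_sum_min (hP1 v) (hP1 (flipBit i v))
  have hmessages (v : ι → Bool) :
      ∑ g : τ → ι → Bool, (∏ t, cubeProb δ v (g t)) * hammingDist (est fun t => m t (g t)) v =
        ∑ y : τ → α, (∏ t, P v t (y t)) * hammingDist (est y) v :=
    sum_prod_mul_comp m fun y => (hammingDist (est y) v : ℝ)
  have htotal : ∑ _v : ι → Bool, (Fintype.card ι / 4 : ℝ) ≤
      2 * ∑ v, ∑ y : τ → α, (∏ t, P v t (y t)) * hammingDist (est y) v :=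
    (sum_le_sum fun v _ => hvertex v).trans (sum_min_flipBit_le _ est)
  simp only [sum_const, card_univ, Fintype.card_pi, Fintype.card_bool, prod_const, nsmul_eq_mul,
    Nat.cast_pow, Nat.cast_ofNat] at htotal
  simp only [hmessages]
  linarith

end Cube

/-! ### The law of the transcript -/

section Transcript

variable {d ℓ T : ℕ} {X : Set (Vec d)} {φ : Code d ℓ}

instance (ℓ : ℕ) (σ2 : ℝ≥0) : IsProbabilityMeasure (channelNoise ℓ σ2) := by
  unfold channelNoise; infer_instance

/-- The randomness of the algorithm together with the first `t` channel outputs, as a function of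
that randomness, the oracle answers `(s.2 j).1` and the channel noises `(s.2 j).2`. -/
def Algorithm.transcript (π : Algorithm X T φ) (t : ℕ)
    (s : π.Ω × (Fin t → Vec d × (Fin ℓ → ℝ))) : π.Ω × (Fin t → Fin ℓ → ℝ) :=
  (s.1, fun j => φ.enc (s.2 j).1 (π.U j s.1) + (s.2 j).2)

theorem Algorithm.measurable_transcript (π : Algorithm X T φ) (t : ℕ) :
    Measurable (π.transcript t) :=
  measurable_fst.prodMk <| measurable_pi_iff.2 fun j =>
    (φ.measurable_enc.comp ((by fun_prop : Measurable fun s : π.Ω × (Fin t → Vec d ×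
      (Fin ℓ → ℝ)) => (s.2 j).1).prodMk ((π.measurable_U j).comp measurable_fst))).add
      (by fun_prop)

/-- One round of the protocol: the channel output for the answer `s.1.2` and the noise `s.2` is
appended to the history `s.1.1`. -/
def Algorithm.appendOutput (π : Algorithm X T φ) (t : ℕ)
    (s : ((π.Ω × (Fin t → Fin ℓ → ℝ)) × Vec d) × (Fin ℓ → ℝ)) :
    π.Ω × (Fin (t + 1) → Fin ℓ → ℝ) :=
  (s.1.1.1, Fin.snoc (α := fun _ => Fin ℓ → ℝ) s.1.1.2 (φ.enc s.1.2 (π.U t s.1.1.1) + s.2))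

theorem Algorithm.measurable_appendOutput (π : Algorithm X T φ) (t : ℕ) :
    Measurable (π.appendOutput t) := by
  refine (by fun_prop : Measurable _).prodMk (measurable_pi_iff.2 fun i => ?_)
  induction i using Fin.lastCases with
  | last =>
    simp only [Fin.snoc_last]
    exact (φ.measurable_enc.comp (Measurable.prodMk (by fun_prop)
      ((π.measurable_U t).comp (by fun_prop)))).add (by fun_prop)
  | cast i => simp only [Fin.snoc_castSucc]; fun_prop

theorem Algorithm.measurePreserving_appendOutput (π : Algorithm X T φ) (σ2 : ℝ≥0)
    (ν : Measure (Vec d)) [SFinite ν] (t : ℕ) [SFinite (π.transcriptLaw σ2 (Kernel.const _ ν) t)] :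
    MeasurePreserving (π.appendOutput t)
      (((π.transcriptLaw σ2 (Kernel.const _ ν) t).prod ν).prod (channelNoise ℓ σ2))
      (π.transcriptLaw σ2 (Kernel.const _ ν) (t + 1)) := by
  refine ⟨π.measurable_appendOutput t, ?_⟩
  rw [← Measure.compProd_const (ν := ν)]
  rfl

theorem Algorithm.measurePreserving_transcript (π : Algorithm X T φ) (σ2 : ℝ≥0)
    (ν : Measure (Vec d)) [IsProbabilityMeasure ν] (t : ℕ) :
    MeasurePreserving (π.transcript t)
      (π.μ.prod (Measure.pi fun _ => ν.prod (channelNoise ℓ σ2)))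
      (π.transcriptLaw σ2 (Kernel.const _ ν) t) := by
  induction t with
  | zero =>
    have empty_law : MeasurePreserving (fun ω => (ω, fun i => i.elim0)) π.μ
        (π.transcriptLaw σ2 (Kernel.const _ ν) 0) := ⟨by fun_prop, rfl⟩
    exact (empty_law.comp measurePreserving_fst).congr (π.measurable_transcript 0)
      (.of_forall fun s => Prod.ext rfl (Subsingleton.elim _ _))
  | succ t ih =>
    let κ : Measure (Vec d × (Fin ℓ → ℝ)) := ν.prod (channelNoise ℓ σ2)
    have : SFinite (π.transcriptLaw σ2 (Kernel.const _ ν) t) := by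
      rw [← ih.map_eq]; infer_instance
    have isolate_last : MeasurePreserving
        (Prod.swap ∘ MeasurableEquiv.piFinSuccAbove _ (Fin.last t))
        (Measure.pi fun _ => κ) ((Measure.pi fun _ => κ).prod κ) :=
      Measure.measurePreserving_swap.comp (measurePreserving_piFinSuccAbove _ _)
    have regroup := (measurePreserving_prodAssoc _ _ _).symm.comp
      ((ih.prod (.id κ)).comp ((measurePreserving_prodAssoc _ _ _).symm.comp
        ((MeasurePreserving.id π.μ).prod isolate_last)))
    refine ((π.measurePreserving_appendOutput σ2 ν t).comp regroup).congr
      (π.measurable_transcript _) (.of_forall fun s => Prod.ext rfl (funext fun j => ?_))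
    induction j using Fin.lastCases with
    | last =>
      simp only [appendOutput, Function.comp_apply, Fin.snoc_last,
        MeasurableEquiv.piFinSuccAbove_apply, Fin.insertNthEquiv_last]
      rfl
    | cast j =>
      simp only [appendOutput, Function.comp_apply, Fin.snoc_castSucc,
        MeasurableEquiv.piFinSuccAbove_apply, Fin.insertNthEquiv_last]
      rfl

theorem Algorithm.lintegral_transcriptLaw_map {α : Type*} [Fintype α] [MeasurableSpace α]
    [DiscreteMeasurableSpace α] (π : Algorithm X T φ) (σ2 : ℝ≥0) {p : α → ℝ}
    (hp : p ∈ stdSimplex ℝ α) (ans : α → Vec d) (t : ℕ)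
    {F : π.Ω × (Fin t → Fin ℓ → ℝ) → ℝ≥0∞} (hF : Measurable F) :
    ∫⁻ s, F s ∂(π.transcriptLaw σ2 (Kernel.const _ ((toPMF hp).toMeasure.map ans)) t) =
      ∫⁻ s, ∑ g : Fin t → α, ENNReal.ofReal (∏ j, p (g j)) *
          F (π.transcript t (s.1, fun j => (ans (g j), s.2 j)))
        ∂(π.μ.prod (Measure.pi fun _ => channelNoise ℓ σ2)) := by
  have hans : Measurable ans := .of_discrete
  have := Measure.isProbabilityMeasure_map (μ := (toPMF hp).toMeasure) hans.aemeasurable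
  have draw := measurePreserving_pi (ι := Fin t) _ _ fun _ =>
    (hans.measurePreserving (toPMF hp).toMeasure).prod (.id (channelNoise ℓ σ2))
  have split := (measurePreserving_arrowProdEquivProdArrow α (Fin ℓ → ℝ) (Fin t)
    (fun _ => (toPMF hp).toMeasure) fun _ => channelNoise ℓ σ2).symm
  have law := (π.measurePreserving_transcript σ2 ((toPMF hp).toMeasure.map ans) t).comp
    (((MeasurePreserving.id π.μ).prod
      (draw.comp (split.comp Measure.measurePreserving_swap))).comp
      (measurePreserving_prodAssoc _ _ _))
  rw [← law.lintegral_comp hF]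
  refine (lintegral_prod _ (hF.comp law.measurable).aemeasurable).trans
    (lintegral_congr fun s => ?_)
  rw [lintegral_fintype]
  refine Finset.sum_congr rfl fun g _ => ?_
  rw [mul_comm, Measure.pi_singleton]
  simp only [toMeasure_toPMF_singleton]
  rw [ENNReal.ofReal_prod_of_nonneg fun j _ => hp.1 _]
  rfl

end Transcript

/-! ### Hard instances -/

section HardInstances

open Finset

variable {d : ℕ}

/-- The cube of half side length `r` around the origin. -/
def box (d : ℕ) (r : ℝ) : Set (Vec d) := {x | ∀ i, |x i| ≤ r}

theorem box_nonempty {r : ℝ} (hr : 0 ≤ r) : (box d r).Nonempty :=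
  ⟨0, fun i => by simpa using hr⟩

theorem convex_box (r : ℝ) : Convex ℝ (box d r) := fun _ hx _ hy _ _ ha hb hab i =>
  abs_le.2 (convex_Icc (-r) r (abs_le.1 (hx i)) (abs_le.1 (hy i)) ha hb hab)

theorem norm_sub_le_of_mem_box {r : ℝ} (hr : 0 ≤ r) {x y : Vec d} (hx : x ∈ box d r)
    (hy : y ∈ box d r) : ‖x - y‖ ≤ 2 * r * √d := by
  have hcoord (i : Fin d) : ‖(x - y) i‖ ≤ 2 * r := by
    rw [PiLp.sub_apply, Real.norm_eq_abs]
    linarith [abs_sub (x i) (y i), hx i, hy i]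
  rw [EuclideanSpace.norm_eq]
  refine Real.sqrt_le_iff.2 ⟨by positivity, ?_⟩
  calc ∑ i, ‖(x - y) i‖ ^ 2 ≤ ∑ _i : Fin d, (2 * r) ^ 2 := by gcongr; exact hcoord _
    _ = (2 * r * √d) ^ 2 := by
      rw [mul_pow _ √(d : ℝ), Real.sq_sqrt (Nat.cast_nonneg d), sum_const, card_univ,
        Fintype.card_fin, nsmul_eq_mul, mul_comm]

/-- The vector in `ℝ^d` with coordinates `± b` that the oracles below use as an answer. The sign
makes `answer b v` the negative of the direction of `v`. -/
noncomputable def answer (b : ℝ) (x : Fin d → Bool) : Vec d :=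
  WithLp.toLp 2 fun i => -b * bitSign (x i)

theorem norm_sq_answer (b : ℝ) (x : Fin d → Bool) : ‖answer b x‖ ^ 2 = d * b ^ 2 := by
  have hcoord (i : Fin d) : ‖answer b x i‖ ^ 2 = b ^ 2 := by
    rw [Real.norm_eq_abs, sq_abs]
    simp only [answer]
    linear_combination b ^ 2 * bitSign_mul_self (x i)
  simp only [EuclideanSpace.norm_sq_eq, hcoord, sum_const, card_univ, Fintype.card_fin,
    nsmul_eq_mul]

theorem sum_cubeProb_smul_answer (b δ : ℝ) (v : Fin d → Bool) :
    ∑ x, cubeProb δ v x • answer b x = answer (b * δ) v := by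
  ext i
  simp only [WithLp.ofLp_sum, Finset.sum_apply, PiLp.smul_apply, smul_eq_mul, answer,
    mul_left_comm (cubeProb _ _ _), ← mul_sum, sum_cubeProb_mul_bitSign]
  ring

/-- On `box d r` this is the function `x ↦ a * ‖x - r v‖₁`, where `v` is read as a vector of
signs. -/
noncomputable def hardFunction (a r : ℝ) (v : Fin d → Bool) (x : Vec d) : ℝ :=
  ∑ i, a * (r - bitSign (v i) * x i)

theorem hardFunction_eq_add_inner (a r : ℝ) (v : Fin d → Bool) (x y : Vec d) :
    hardFunction a r v y = hardFunction a r v x + inner ℝ (answer a v) (y - x) := by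
  simp only [hardFunction, PiLp.inner_apply, answer, ← sum_add_distrib, PiLp.sub_apply,
    RCLike.inner_apply, conj_trivial]
  exact sum_congr rfl fun i _ => by ring

theorem convexOn_hardFunction (a r : ℝ) (v : Fin d → Bool) {X : Set (Vec d)} (hX : Convex ℝ X) :
    ConvexOn ℝ X (hardFunction a r v) := by
  have haffine : hardFunction a r v =
      fun x => (innerₛₗ ℝ (answer a v)) x + hardFunction a r v 0 := by
    funext x
    rw [hardFunction_eq_add_inner a r v 0 x, sub_zero, add_comm]
    rfl
  rw [haffine]
  exact ((innerₛₗ ℝ (answer a v)).convexOn hX).add_const _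

/-- The vertex of the cube in the orthant of `x`. -/
noncomputable def signPattern (x : Vec d) : Fin d → Bool := fun i => decide (0 ≤ x i)

theorem measurable_signPattern : Measurable (signPattern (d := d)) :=
  measurable_pi_iff.2 fun i => measurable_to_bool <| by
    have hpre : (fun x : Vec d => signPattern x i) ⁻¹' {true} = {x | 0 ≤ x i} := by
      ext x
      exact decide_eq_true_iff
    rw [hpre]
    exact measurableSet_le measurable_const (by fun_prop)

theorem mul_hammingDist_le_hardFunction {a r : ℝ} (ha : 0 ≤ a) (v : Fin d → Bool) {x : Vec d}
    (hx : x ∈ box d r) : a * r * hammingDist (signPattern x) v ≤ hardFunction a r v x := by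
  rw [hammingDist, card_filter, Nat.cast_sum, mul_sum]
  refine sum_le_sum fun i _ => ?_
  rw [mul_assoc]
  refine mul_le_mul_of_nonneg_left ?_ ha
  obtain ⟨hl, hu⟩ := abs_le.1 (hx i)
  by_cases h0 : 0 ≤ x i <;> cases v i <;> simp [signPattern, h0, bitSign] <;> linarith

theorem sInf_hardFunction_le {a r : ℝ} (ha : 0 ≤ a) (hr : 0 ≤ r) (v : Fin d → Bool) :
    sInf (hardFunction a r v '' box d r) ≤ 0 := by
  refine csInf_le ⟨0, ?_⟩ ⟨WithLp.toLp 2 fun i => r * bitSign (v i), fun i => ?_, ?_⟩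
  · rintro _ ⟨x, hx, rfl⟩
    exact (by positivity : (0 : ℝ) ≤ a * r * hammingDist (signPattern x) v).trans
      (mul_hammingDist_le_hardFunction ha v hx)
  · cases h : v i <;> simp [h, bitSign, abs_of_nonneg hr]
  · refine sum_eq_zero fun i _ => ?_
    simp only
    linear_combination (-a * r) * bitSign_mul_self (v i)

/-- The law of the random answers `answer b x` when `x` has the law `cubeProb δ v`. -/
noncomputable def answerLaw (b : ℝ) {δ : ℝ} (hδ : |δ| ≤ 1) (v : Fin d → Bool) :
    Measure (Vec d) :=
  (toPMF (cubeProb_mem_stdSimplex hδ v)).toMeasure.map (answer b)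

instance (b : ℝ) {δ : ℝ} (hδ : |δ| ≤ 1) (v : Fin d → Bool) :
    IsProbabilityMeasure (answerLaw b hδ v) :=
  Measure.isProbabilityMeasure_map Measurable.of_discrete.aemeasurable

theorem integral_answerLaw (b : ℝ) {δ : ℝ} (hδ : |δ| ≤ 1) (v : Fin d → Bool) :
    ∫ g, g ∂(answerLaw b hδ v) = answer (b * δ) v := by
  rw [answerLaw, integral_map Measurable.of_discrete.aemeasurable
    (by fun_prop), integral_toPMF, sum_cubeProb_smul_answer]

theorem lintegral_norm_sq_answerLaw (b : ℝ) {δ : ℝ} (hδ : |δ| ≤ 1) (v : Fin d → Bool) :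
    ∫⁻ g, ‖g‖ₑ ^ 2 ∂(answerLaw b hδ v) = ENNReal.ofReal (d * b ^ 2) := by
  have hnorm (x : Fin d → Bool) : ‖answer b x‖ₑ ^ 2 = ENNReal.ofReal (d * b ^ 2) := by
    rw [← ofReal_norm, ← ENNReal.ofReal_pow (norm_nonneg _), norm_sq_answer]
  rw [answerLaw, lintegral_map (by fun_prop) .of_discrete]
  simp only [hnorm, lintegral_const, measure_univ, mul_one]

/-- The function `hardFunction` with an oracle that gives the same random answers at all points,
so that queries reveal `v` only through independent samples of the biased cube. -/
noncomputable def hardPair (B r : ℝ) {δ : ℝ} (hδ : |δ| ≤ 1) (v : Fin d → Bool) :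
    OraclePair (box d r) B where
  f := hardFunction (B / √d * δ) r v
  oracle := Kernel.const _ (answerLaw (B / √d) hδ v)
  markov := inferInstance
  convex := convexOn_hardFunction _ _ _ (convex_box r)
  unbiased x _ y _ := by
    rw [Kernel.const_apply, integral_answerLaw]
    exact (hardFunction_eq_add_inner _ _ _ _ _).ge
  meanSquare x _ := by
    rw [Kernel.const_apply, lintegral_norm_sq_answerLaw, div_pow, Real.sq_sqrt (Nat.cast_nonneg d)]
    refine ENNReal.ofReal_le_ofReal ?_
    rcases eq_or_ne (d : ℝ) 0 with hd | hd
    · rw [hd, zero_mul]; positivity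
    · rw [mul_div_cancel₀ _ hd]

theorem Algorithm.lintegral_hammingDist_le_error {ℓ T : ℕ} {φ : Code d ℓ} {B r δ : ℝ}
    (hB : 0 ≤ B) (hr : 0 ≤ r) (hδ0 : 0 ≤ δ) (hδ : |δ| ≤ 1) (v : Fin d → Bool)
    (π : Algorithm (box d r) T φ) (σ2 : ℝ≥0) :
    ∫⁻ s, ENNReal.ofReal (B / √d * δ * r * hammingDist (signPattern (π.output s)) v)
        ∂(π.transcriptLaw σ2 (hardPair B r hδ v).oracle T) ≤ π.error σ2 (hardPair B r hδ v) := by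
  have ha : 0 ≤ B / √d * δ := by positivity
  refine lintegral_mono fun s => ENNReal.ofReal_le_ofReal ?_
  have hmin := sInf_hardFunction_le (d := d) ha hr v
  have houtput := mul_hammingDist_le_hardFunction ha v (π.output_mem s)
  change _ ≤ hardFunction (B / √d * δ) r v _ - sInf (hardFunction (B / √d * δ) r v '' _)
  linarith

end HardInstances

/-! ### Codes with finitely many messages -/

section FiniteMessages

open Finset

variable {d ℓ T : ℕ} {φ : Code d ℓ}

/-- On inputs from `A` the codeword is a function of the public randomness and of a message from
the alphabet `α`, which is itself a function of the input and of the public randomness. -/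
def Code.FactorsThrough (φ : Code d ℓ) (α : Type*) (A : Set (Vec d)) : Prop :=
  ∃ (m : φ.𝒰 → Vec d → α) (e : φ.𝒰 → α → Fin ℓ → ℝ), ∀ u, ∀ x ∈ A, φ.enc x u = e u (m u x)

theorem Code.FactorsThrough.le_sum_hammingDist {α : Type*} [Fintype α] {b δ : ℝ} {X : Set (Vec d)}
    (hφ : φ.FactorsThrough α (Set.range (answer b))) (hδ : |δ| ≤ 1 / 2)
    (hT : T * (8 * δ ^ 2 * min (d : ℝ) (Real.log (Fintype.card α))) ≤ d / 4)
    (π : Algorithm X T φ) (s : π.Ω × (Fin T → Fin ℓ → ℝ)) :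
    2 ^ d * (d / 8 : ℝ) ≤ ∑ v, ∑ g : Fin T → Fin d → Bool, (∏ t, cubeProb δ v (g t)) *
      hammingDist (signPattern
        (π.output (π.transcript T (s.1, fun j => (answer b (g j), s.2 j))))) v := by
  obtain ⟨m, e, he⟩ := hφ
  have assouad := le_sum_cubeProb_mul_hammingDist hδ (ι := Fin d) (τ := Fin T) (α := α)
    (by simpa only [Fintype.card_fin] using hT) (fun t x => m (π.U t s.1) (answer b x))
    fun y => signPattern (π.output (s.1, fun t => e (π.U t s.1) (y t) + s.2 t))
  simpa only [Fintype.card_fin, Algorithm.transcript, he _ _ (Set.mem_range_self _)] using assouad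

theorem Code.FactorsThrough.le_sum_lintegral_hammingDist {α : Type*} [Fintype α] {b c δ : ℝ}
    {X : Set (Vec d)} (hφ : φ.FactorsThrough α (Set.range (answer b))) (hc : 0 ≤ c)
    (hδ1 : |δ| ≤ 1) (hδ : |δ| ≤ 1 / 2)
    (hT : T * (8 * δ ^ 2 * min (d : ℝ) (Real.log (Fintype.card α))) ≤ d / 4)
    (π : Algorithm X T φ) (σ2 : ℝ≥0) :
    2 ^ d * ENNReal.ofReal (c * (d / 8)) ≤ ∑ v : Fin d → Bool,
      ∫⁻ s, ENNReal.ofReal (c * hammingDist (signPattern (π.output s)) v)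
        ∂(π.transcriptLaw σ2 (Kernel.const _ (answerLaw b hδ1 v)) T) := by
  let loss (v : Fin d → Bool) (s : π.Ω × (Fin T → Fin ℓ → ℝ)) : ℝ≥0∞ :=
    ENNReal.ofReal (c * hammingDist (signPattern (π.output s)) v)
  have hloss (v) : Measurable (loss v) :=
    (Measurable.of_discrete (f := fun w => ENNReal.ofReal (c * hammingDist w v))).comp
      (measurable_signPattern.comp π.measurable_output)
  let ρ := π.μ.prod (Measure.pi fun _ : Fin T => channelNoise ℓ σ2)
  let replay (g : Fin T → Fin d → Bool) (s : π.Ω × (Fin T → Fin ℓ → ℝ)) :=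
    π.transcript T (s.1, fun j => (answer b (g j), s.2 j))
  have hreplay (g) : Measurable (replay g) := (π.measurable_transcript T).comp (by fun_prop)
  have pointwise (s) : ENNReal.ofReal (2 ^ d * (c * (d / 8))) ≤
      ∑ v, ∑ g, ENNReal.ofReal (∏ t, cubeProb δ v (g t)) * loss v (replay g s) := by
    have hprob (v) (g : Fin T → Fin d → Bool) : 0 ≤ ∏ t, cubeProb δ v (g t) :=
      prod_nonneg fun t _ => (cubeProb_mem_stdSimplex hδ1 v).1 _
    have hterm (v g) : 0 ≤ (∏ t, cubeProb δ v (g t)) *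
        (c * hammingDist (signPattern (π.output (replay g s))) v) :=
      mul_nonneg (hprob v g) (by positivity)
    simp only [loss, ← ENNReal.ofReal_mul (hprob _ _), ← ENNReal.ofReal_sum_of_nonneg
      fun g _ => hterm _ g]
    rw [← ENNReal.ofReal_sum_of_nonneg fun v _ => sum_nonneg fun g _ => hterm v g]
    simp only [mul_left_comm _ c, ← mul_sum]
    gcongr
    exact hφ.le_sum_hammingDist hδ hT π s
  calc 2 ^ d * ENNReal.ofReal (c * (d / 8))
      = ∫⁻ _, ENNReal.ofReal (2 ^ d * (c * (d / 8))) ∂ρ := by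
        rw [lintegral_const, measure_univ, mul_one,
          ENNReal.ofReal_mul (p := 2 ^ d) (by positivity), ENNReal.ofReal_pow zero_le_two,
          ENNReal.ofReal_ofNat]
    _ ≤ ∫⁻ s, ∑ v, ∑ g, ENNReal.ofReal (∏ t, cubeProb δ v (g t)) * loss v (replay g s) ∂ρ :=
        lintegral_mono pointwise
    _ = ∑ v, ∫⁻ s, ∑ g, ENNReal.ofReal (∏ t, cubeProb δ v (g t)) * loss v (replay g s) ∂ρ :=
        lintegral_finsetSum _ fun v _ => Finset.measurable_sum _ fun g _ =>
          ((hloss v).comp (hreplay g)).const_mul _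
    _ = _ := sum_congr rfl fun v _ => (π.lintegral_transcriptLaw_map σ2
        (cubeProb_mem_stdSimplex hδ1 v) (answer b) T (hloss v)).symm

theorem Code.FactorsThrough.le_iSup_error {α : Type*} [Fintype α] {B r δ : ℝ} (hB : 0 ≤ B)
    (hr : 0 ≤ r) (hδ0 : 0 ≤ δ) (hδ : δ ≤ 1 / 2)
    (hφ : φ.FactorsThrough α (Set.range (answer (B / √d))))
    (hT : T * (8 * δ ^ 2 * min (d : ℝ) (Real.log (Fintype.card α))) ≤ d / 4)
    (π : Algorithm (box d r) T φ) (σ2 : ℝ≥0) :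
    ENNReal.ofReal (B / √d * δ * r * (d / 8)) ≤ ⨆ p : OraclePair (box d r) B, π.error σ2 p := by
  have hδ_abs : |δ| ≤ 1 / 2 := by rwa [abs_of_nonneg hδ0]
  have hδ1 : |δ| ≤ 1 := hδ_abs.trans (by norm_num)
  have averaged : 2 ^ d * ENNReal.ofReal (B / √d * δ * r * (d / 8)) ≤
      2 ^ d * ⨆ p : OraclePair (box d r) B, π.error σ2 p := by
    calc 2 ^ d * ENNReal.ofReal (B / √d * δ * r * (d / 8))
        ≤ ∑ v, π.error σ2 (hardPair B r hδ1 v) :=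
          (hφ.le_sum_lintegral_hammingDist (by positivity) hδ1 hδ_abs hT π σ2).trans
            (sum_le_sum fun v _ => π.lintegral_hammingDist_le_error hB hr hδ0 hδ1 v σ2)
      _ ≤ ∑ _v : Fin d → Bool, ⨆ p : OraclePair (box d r) B, π.error σ2 p :=
          sum_le_sum fun v _ => le_iSup (fun p => π.error σ2 p) _
      _ = 2 ^ d * ⨆ p : OraclePair (box d r) B, π.error σ2 p := by simp
  exact (ENNReal.mul_le_mul_iff_right (by simp) (by simp)).1 averaged

end FiniteMessages

/-! ### Coordinate sampling -/

section CoordinateSampling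

open Finset

variable {d k ℓ : ℕ}

/-- The messages of a `k`-coordinate sampling code on inputs whose coordinates take two values: a
set of `k` coordinates with a bit for each of them. -/
abbrev SampledBits (d k : ℕ) : Type := Σ s : {s : Finset (Fin d) // s.card = k}, (s.1 → Bool)

theorem card_sampledBits (d k : ℕ) : Fintype.card (SampledBits d k) = d.choose k * 2 ^ k := by
  have hbits (s : {s : Finset (Fin d) // s.card = k}) : Fintype.card (s.1 → Bool) = 2 ^ k := by
    rw [Fintype.card_fun, Fintype.card_bool, Fintype.card_coe, s.2]
  simp only [Fintype.card_sigma, hbits, sum_const, card_univ, Fintype.card_finset_len,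
    Fintype.card_fin, smul_eq_mul]

theorem log_choose_le (hkd : k ≤ d) :
    Real.log (d.choose k) ≤ k * Real.log ((d : ℝ) / k) + k := by
  have hchoose_pos : (0 : ℝ) < d.choose k := by exact_mod_cast Nat.choose_pos hkd
  have hpow_self : (k : ℝ) ^ k ≠ 0 := by exact_mod_cast Nat.pow_self_pos.ne'
  have hchoose : (d.choose k : ℝ) ≤ ((d : ℝ) / k) ^ k * Real.exp k := by
    calc (d.choose k : ℝ) ≤ (d : ℝ) ^ k / k.factorial := Nat.choose_le_pow_div k d
      _ = ((d : ℝ) / k) ^ k * ((k : ℝ) ^ k / k.factorial) := by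
        rw [div_pow, ← mul_div_assoc, div_mul_cancel₀ _ hpow_self]
      _ ≤ ((d : ℝ) / k) ^ k * Real.exp k := by
        gcongr
        exact Real.pow_div_factorial_le_exp _ k.cast_nonneg k
  have hpow : ((d : ℝ) / k) ^ k ≠ 0 := left_ne_zero_of_mul (hchoose_pos.trans_le hchoose).ne'
  simpa only [Real.log_mul hpow (Real.exp_ne_zero _), Real.log_pow, Real.log_exp] using
    Real.log_le_log hchoose_pos hchoose

theorem logb_two_div_nonneg (hk : 1 ≤ k) (hkd : k ≤ d) : 0 ≤ Real.logb 2 ((d : ℝ) / k) :=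
  Real.logb_nonneg one_lt_two <| (one_le_div (by exact_mod_cast hk)).2 (by exact_mod_cast hkd)

theorem one_le_logb_two_div (hk : 1 ≤ k) (hkd : 2 * k ≤ d) : 1 ≤ Real.logb 2 ((d : ℝ) / k) := by
  have hk0 : (0 : ℝ) < k := by exact_mod_cast hk
  have hdk : 2 ≤ (d : ℝ) / k := (le_div_iff₀ hk0).2 (by exact_mod_cast hkd)
  rw [← Real.logb_self_eq_one one_lt_two]
  exact Real.logb_le_logb_of_le one_lt_two two_pos hdk

theorem log_card_sampledBits_le (hk : 1 ≤ k) (hkd : k ≤ d) :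
    Real.log (Fintype.card (SampledBits d k)) ≤ 2 * (k * (1 + Real.logb 2 ((d : ℝ) / k))) := by
  have hlog : Real.log ((d : ℝ) / k) = Real.log 2 * Real.logb 2 ((d : ℝ) / k) :=
    (mul_div_cancel₀ _ (Real.log_pos one_lt_two).ne').symm
  have hchoose_ne : (d.choose k : ℝ) ≠ 0 := by exact_mod_cast (Nat.choose_pos hkd).ne'
  have hL := logb_two_div_nonneg hk hkd
  calc Real.log (Fintype.card (SampledBits d k))
      = Real.log (d.choose k) + k * Real.log 2 := by
        rw [card_sampledBits, Nat.cast_mul, Nat.cast_pow, Nat.cast_ofNat,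
          Real.log_mul hchoose_ne (by positivity), Real.log_pow]
    _ ≤ k * (Real.log 2 * Real.logb 2 ((d : ℝ) / k)) + k + k * Real.log 2 := by
        gcongr
        exact hlog ▸ log_choose_le hkd
    _ ≤ k * (1 * Real.logb 2 ((d : ℝ) / k)) + k + k * 1 := by
        have := Real.log_two_lt_d9
        gcongr <;> linarith
    _ ≤ 2 * (k * (1 + Real.logb 2 ((d : ℝ) / k))) := by
        linarith [mul_nonneg k.cast_nonneg hL]

theorem Code.IsCoordinateSampling.factorsThrough {φ : Code d ℓ} (hφ : φ.IsCoordinateSampling k)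
    (b : ℝ) : φ.FactorsThrough (SampledBits d k) (Set.range (answer b)) := by
  classical
  obtain ⟨S, e, hS, he⟩ := hφ
  refine ⟨fun u x => ⟨⟨S x u, hS x u⟩, fun i => decide (x i = b)⟩,
    fun u y => e u y.1.1 fun i => if y.2 i then b else -b, ?_⟩
  rintro u _ ⟨v, rfl⟩
  rw [he]
  congr 1
  funext i
  have hcoord : answer b v i = b ∨ answer b v i = -b := by
    cases hv : v i <;> simp [answer, bitSign, hv]
  simp only [decide_eq_true_eq]
  split_ifs with h
  exacts [h, hcoord.resolve_left h]

end CoordinateSampling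

/-! ### Min-max lower bounds -/

section LowerBound

variable {d k n : ℕ} {D B : ℝ}

/-- The min-max error with at most `n` oracle queries on domains of diameter at most `D`, when the
codes are restricted to the class `𝒞`. Neither the length nor the power of the codes is bounded, so
only the class `𝒞` limits the information that the algorithm gets. -/
noncomputable def queryMinMaxError (𝒞 : ∀ d ℓ : ℕ, Code d ℓ → Prop) (d n : ℕ) (D B : ℝ)
    (σ2 : ℝ≥0) : ℝ≥0∞ :=
  ⨆ (X : Set (Vec d)) (_ : X.Nonempty) (_ : Convex ℝ X) (_ : ∀ x ∈ X, ∀ y ∈ X, ‖x - y‖ ≤ D),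
    ⨅ (ℓ : ℕ) (T : ℕ) (_ : T ≤ n) (φ : Code d ℓ) (_ : 𝒞 d ℓ φ) (π : Algorithm X T φ),
      ⨆ p : OraclePair X B, π.error σ2 p

theorem queryMinMaxError_le_minMaxError (𝒞 : ∀ d ℓ : ℕ, Code d ℓ → Prop) (d n : ℕ) (D B P : ℝ)
    (σ2 : ℝ≥0) : queryMinMaxError 𝒞 d n D B σ2 ≤ minMaxError 𝒞 d n D B P σ2 := by
  refine iSup_mono fun X => iSup_mono fun _ => iSup_mono fun _ => iSup_mono fun _ =>
    iInf_mono fun ℓ => iInf_mono fun T => le_iInf fun hℓ => le_iInf fun hT => ?_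
  exact iInf_le_of_le ((Nat.le_mul_of_pos_left T hℓ).trans hT) <|
    iInf_mono fun φ => iInf_mono fun _ => iInf_mono fun π => le_iInf fun _ => le_rfl

theorem le_queryMinMaxError {𝒞 : ∀ d ℓ : ℕ, Code d ℓ → Prop} {α : Type*} [Fintype α]
    (h𝒞 : ∀ (ℓ : ℕ) (φ : Code d ℓ), 𝒞 d ℓ φ → ∀ b, φ.FactorsThrough α (Set.range (answer b)))
    (hD : 0 ≤ D) (hB : 0 ≤ B) (hd : 0 < d) {I : ℝ} (hI : 0 < I)
    (hα : min (d : ℝ) (Real.log (Fintype.card α)) ≤ 4 * I) (hn : d / I ≤ n) (σ2 : ℝ≥0) :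
    ENNReal.ofReal (1 / 192 * D * B / √(n : ℝ) * √(d / I)) ≤
      queryMinMaxError 𝒞 d n D B σ2 := by
  have hd0 : (0 : ℝ) < d := by exact_mod_cast hd
  have hn0 : (0 : ℝ) < n := (div_pos hd0 hI).trans_le hn
  let r := D / (2 * √(d : ℝ))
  let δ := 1 / 12 * (√(d / I) / √(n : ℝ))
  have hr : 0 ≤ r := by positivity
  have hδ0 : 0 ≤ δ := by positivity
  have hδ : δ ≤ 1 / 2 := by
    have : √(d / I) / √(n : ℝ) ≤ 1 := div_le_one_of_le₀ (Real.sqrt_le_sqrt hn) (Real.sqrt_nonneg _)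
    simp only [δ]
    linarith
  have hinfo : n * (8 * δ ^ 2 * (4 * I)) ≤ d / 4 := by
    simp only [δ, mul_pow, div_pow, Real.sq_sqrt (div_pos hd0 hI).le, Real.sq_sqrt hn0.le]
    field_simp
    norm_num
  have hdiam : 2 * r * √d = D := by
    simp only [r]
    field_simp
  have herror : B / √d * δ * r * (d / 8) = 1 / 192 * D * B / √(n : ℝ) * √(d / I) := by
    calc B / √d * δ * r * (d / 8)
        = 1 / 192 * D * B / √(n : ℝ) * √(d / I) * (d / (√d * √d)) := by simp only [r, δ]; ring
      _ = 1 / 192 * D * B / √(n : ℝ) * √(d / I) := by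
        rw [Real.mul_self_sqrt hd0.le, div_self hd0.ne', mul_one]
  refine le_iSup_of_le (box d r) <| le_iSup_of_le (box_nonempty hr) <|
    le_iSup_of_le (convex_box r) <|
    le_iSup_of_le (fun x hx y hy => hdiam ▸ norm_sub_le_of_mem_box hr hx hy) ?_
  refine le_iInf fun ℓ => le_iInf fun T => le_iInf fun hT => le_iInf fun φ => le_iInf fun hφ =>
    le_iInf fun π => ?_
  rw [← herror]
  refine (h𝒞 ℓ φ hφ _).le_iSup_error hB hr hδ0 hδ (hinfo.trans' ?_) π σ2
  gcongr

/-- The min-max error of `k`-coordinate sampling codes with at most `n` oracle queries. -/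
noncomputable def queryKcsError (k d n : ℕ) (D B : ℝ) (σ2 : ℝ≥0) : ℝ≥0∞ :=
  queryMinMaxError (fun _ _ φ => φ.IsCoordinateSampling k) d n D B σ2

theorem queryKcsError_le_kcsError (k d n : ℕ) (D B P : ℝ) (σ2 : ℝ≥0) :
    queryKcsError k d n D B σ2 ≤ kcsError k d n D B P σ2 :=
  queryMinMaxError_le_minMaxError _ d n D B P σ2

theorem le_queryKcsError (hD : 0 ≤ D) (hB : 0 ≤ B) (hk : 1 ≤ k) (hkd : k ≤ d) {I : ℝ}
    (hI : 0 < I) (hcard : min (d : ℝ) (2 * (k * (1 + Real.logb 2 ((d : ℝ) / k)))) ≤ 4 * I)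
    (hn : d / I ≤ n) (σ2 : ℝ≥0) :
    ENNReal.ofReal (1 / 192 * D * B / √(n : ℝ) * √(d / I)) ≤ queryKcsError k d n D B σ2 :=
  le_queryMinMaxError (fun _ _ hφ b => hφ.factorsThrough b) hD hB (by omega) hI
    (hcard.trans' (min_le_min_left _ (log_card_sampledBits_le hk hkd))) hn σ2

theorem le_queryKcsError_one_add_logb (hD : 0 ≤ D) (hB : 0 ≤ B) (hk : 1 ≤ k) (hkd : k ≤ d)
    (hn : (d : ℝ) / min (d : ℝ) (k * (1 + Real.logb 2 ((d : ℝ) / k))) ≤ n) (σ2 : ℝ≥0) :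
    ENNReal.ofReal (1 / 192 * D * B / √(n : ℝ) *
        √((d : ℝ) / min (d : ℝ) (k * (1 + Real.logb 2 ((d : ℝ) / k))))) ≤
      queryKcsError k d n D B σ2 := by
  have hk0 : (0 : ℝ) < k := by exact_mod_cast hk
  have hL := logb_two_div_nonneg hk hkd
  refine le_queryKcsError hD hB hk hkd (lt_min (hk0.trans_le (by exact_mod_cast hkd))
    (by positivity)) ?_ hn σ2
  rw [mul_min_of_nonneg _ _ zero_le_four]
  gcongr <;> linarith

theorem le_queryKcsError_logb (hD : 0 ≤ D) (hB : 0 ≤ B) (hk : 1 ≤ k) (hkd : 2 * k ≤ d)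
    (hn : (d : ℝ) / min (d : ℝ) (k * Real.logb 2 ((d : ℝ) / k)) ≤ n) (σ2 : ℝ≥0) :
    ENNReal.ofReal (1 / 192 * D * B / √(n : ℝ) *
        √((d : ℝ) / min (d : ℝ) (k * Real.logb 2 ((d : ℝ) / k)))) ≤
      queryKcsError k d n D B σ2 := by
  have hk0 : (0 : ℝ) < k := by exact_mod_cast hk
  have hL := one_le_logb_two_div hk hkd
  refine le_queryKcsError hD hB hk (by omega) (lt_min (by norm_cast; omega)
    (by positivity)) ?_ hn σ2
  rw [mul_min_of_nonneg _ _ zero_le_four]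
  exact min_le_min (by linarith) (by linarith [le_mul_of_one_le_right hk0.le hL])

theorem exists_forall_mul_logb_le (K : ℝ) : ∃ x₀ : ℝ, ∀ x ≥ x₀, K * Real.logb 2 x ≤ x := by
  have hlog : (fun x => K * Real.logb 2 x) =o[Filter.atTop] (id : ℝ → ℝ) := by
    simp only [Real.logb, div_eq_inv_mul]
    exact (Real.isLittleO_log_id_atTop.const_mul_left _).const_mul_left _
  refine Filter.eventually_atTop.1 ?_
  filter_upwards [hlog.bound one_pos, Filter.eventually_ge_atTop 0] with x hx hx0
  rw [one_mul, id, Real.norm_of_nonneg hx0] at hx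
  exact (le_abs_self _).trans hx

theorem exists_le_queryKcsError (C : ℝ) : ∃ ε : ℝ, 0 < ε ∧ ε ≤ 1 / 2 ∧
    ∀ (d k n : ℕ) (D B : ℝ) (σ2 : ℝ≥0), 0 ≤ D → 0 ≤ B → 1 ≤ k → (k : ℝ) ≤ ε * d →
      (d : ℝ) / min (d : ℝ) (k * Real.logb 2 ((d : ℝ) / k)) ≤ n →
        ENNReal.ofReal (C * D * B / √(n : ℝ)) ≤ queryKcsError k d n D B σ2 := by
  obtain ⟨x₀, hx₀⟩ := exists_forall_mul_logb_le ((192 * C) ^ 2)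
  refine ⟨1 / max 2 x₀, by positivity, one_div_le_one_div_of_le two_pos (le_max_left _ _),
    fun d k n D B σ2 hD hB hk hkd hn => ?_⟩
  have hk0 : (0 : ℝ) < k := by exact_mod_cast hk
  have hratio : max 2 x₀ ≤ (d : ℝ) / k := by
    rw [one_div_mul_eq_div, le_div_iff₀ (by positivity)] at hkd
    rwa [le_div_iff₀ hk0, mul_comm]
  have h2k : 2 * k ≤ d := by
    exact_mod_cast (le_div_iff₀ hk0).1 ((le_max_left _ _).trans hratio)
  have hL := one_le_logb_two_div hk h2k
  have hC : 192 * C ≤ √((d : ℝ) / min (d : ℝ) (k * Real.logb 2 ((d : ℝ) / k))) := by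
    refine Real.le_sqrt_of_sq_le ?_
    rw [le_div_iff₀ (lt_min (by norm_cast; omega) (by positivity))]
    calc (192 * C) ^ 2 * min (d : ℝ) (k * Real.logb 2 ((d : ℝ) / k))
        ≤ (192 * C) ^ 2 * (k * Real.logb 2 ((d : ℝ) / k)) := by gcongr; exact min_le_right _ _
      _ = k * ((192 * C) ^ 2 * Real.logb 2 ((d : ℝ) / k)) := mul_left_comm _ _ _
      _ ≤ k * (d / k) := by gcongr; exact hx₀ _ ((le_max_right _ _).trans hratio)
      _ = d := mul_div_cancel₀ _ hk0.ne'
  refine (ENNReal.ofReal_le_ofReal ?_).trans (le_queryKcsError_logb hD hB hk h2k hn σ2)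
  calc C * D * B / √(n : ℝ) = 1 / 192 * D * B / √(n : ℝ) * (192 * C) := by ring
    _ ≤ _ := by gcongr

end LowerBound

end OverTheAir

theorem mainTheorem7_general :
    (∃ c : ℝ, 0 < c ∧
      ∀ (d k n : ℕ) (D B : ℝ) (σ2 : ℝ≥0), 0 ≤ D → 0 ≤ B → 1 ≤ k →
        (2 * k ≤ d →
          (d : ℝ) / min (d : ℝ) (k * Real.logb 2 ((d : ℝ) / k)) ≤ n →
          ENNReal.ofReal (c * D * B / √(n : ℝ) *
              √((d : ℝ) / min (d : ℝ) (k * Real.logb 2 ((d : ℝ) / k))))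
            ≤ OverTheAir.queryKcsError k d n D B σ2) ∧
        (k ≤ d →
          (d : ℝ) / min (d : ℝ) (k * (1 + Real.logb 2 ((d : ℝ) / k))) ≤ n →
          ENNReal.ofReal (c * D * B / √(n : ℝ) *
              √((d : ℝ) / min (d : ℝ) (k * (1 + Real.logb 2 ((d : ℝ) / k)))))
            ≤ OverTheAir.queryKcsError k d n D B σ2)) ∧
    (∀ C : ℝ, ∃ ε : ℝ, 0 < ε ∧ ε ≤ 1 / 2 ∧
      ∀ (d k n : ℕ) (D B : ℝ) (σ2 : ℝ≥0), 0 ≤ D → 0 ≤ B → 1 ≤ k → (k : ℝ) ≤ ε * d →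
        (d : ℝ) / min (d : ℝ) (k * Real.logb 2 ((d : ℝ) / k)) ≤ n →
          ENNReal.ofReal (C * D * B / √(n : ℝ)) ≤ OverTheAir.queryKcsError k d n D B σ2) :=
  ⟨⟨1 / 192, by norm_num, fun _ _ _ _ _ σ2 hD hB hk =>
    ⟨fun hkd hn => OverTheAir.le_queryKcsError_logb hD hB hk hkd hn σ2,
      fun hkd hn => OverTheAir.le_queryKcsError_one_add_logb hD hB hk hkd hn σ2⟩⟩,
    OverTheAir.exists_le_queryKcsError⟩

theorem mainTheorem7 :
    (∃ c : ℝ, 0 < c ∧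
      ∀ (d k N : ℕ) (D B P : ℝ) (σ2 : ℝ≥0), 0 < D → 0 < B → 0 < P → 1 ≤ k →
        (2 * k ≤ d →
          (d : ℝ) / min (d : ℝ) (k * Real.logb 2 ((d : ℝ) / k)) ≤ N →
          ENNReal.ofReal (c * D * B / √(N : ℝ) *
              √((d : ℝ) / min (d : ℝ) (k * Real.logb 2 ((d : ℝ) / k))))
            ≤ OverTheAir.kcsError k d N D B P σ2) ∧
        (k ≤ d →
          (d : ℝ) / min (d : ℝ) (k * (1 + Real.logb 2 ((d : ℝ) / k))) ≤ N →
          ENNReal.ofReal (c * D * B / √(N : ℝ) *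
              √((d : ℝ) / min (d : ℝ) (k * (1 + Real.logb 2 ((d : ℝ) / k)))))
            ≤ OverTheAir.kcsError k d N D B P σ2)) ∧
    (∀ C : ℝ, 0 < C → ∃ ε : ℝ, 0 < ε ∧ ε ≤ 1 / 2 ∧
      ∀ (d k N : ℕ) (D B P : ℝ), 0 < D → 0 < B → 0 < P → 1 ≤ k → (k : ℝ) ≤ ε * d →
        (d : ℝ) / min (d : ℝ) (k * Real.logb 2 ((d : ℝ) / k)) ≤ N →
          ENNReal.ofReal (C * D * B / √(N : ℝ)) ≤ OverTheAir.kcsError k d N D B P 0) := by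
  obtain ⟨⟨c, hc, hbounds⟩, hclassic⟩ := mainTheorem7_general
  have hquery := OverTheAir.queryKcsError_le_kcsError
  refine ⟨⟨c, hc, fun d k N D B P σ2 hD hB _ hk =>
    ⟨fun hkd hN => ((hbounds d k N D B σ2 hD.le hB.le hk).1 hkd hN).trans (hquery ..),
      fun hkd hN => ((hbounds d k N D B σ2 hD.le hB.le hk).2 hkd hN).trans (hquery ..)⟩⟩,
    fun C _ => ?_⟩
  obtain ⟨ε, hε0, hε, hbound⟩ := hclassic C
  exact ⟨ε, hε0, hε, fun d k N D B P hD hB _ hk hkd hN =>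
    (hbound d k N D B 0 hD.le hB.le hk hkd hN).trans (hquery ..)⟩
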